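/- \textbf{Theorem (prime Leavitt path algebras).} Let $E=(E^0,E^1)$ be a directed graph with at least one vertex (with no finiteness or countability assumption), with source and range maps $s,r\colon E^1\to E^0$, and let $R$ be a commutative ring with unit. The Leavitt path algebra $L_R(E)$ is the associative, not necessarily unital, $R$-algebra generated by a set $\{v \mid v\in E^0\}$ of pairwise orthogonal idempotents and a set of variables $\{e,e^*\mid e\in E^1\}$ subject to the relations \begin{enumerate} \item $s(e)e=e=e\,r(e)$ for all $e\in E^1$; \item $r(e)e^*=e^*=e^*s(e)$ for all $e\in E^1$; \item $e^*e'=\delta_{e,e'}\,r(e)$ for all $e,e'\in E^1$; \item $v=\sum_{e\in s^{-1}(v)}ee^*$ for every $v\in E^0$ such that $s^{-1}(v)$ is finite and non-empty. \end{enumerate} Then $L_R(E)$ is a prime ring if and only if $R$ is an integral domain and $E$ is downward directed. Here a ring $A$ (not necessarily unital) is prime if $A\neq 0$ and, for all two-sided ideals $I,J$ of $A$, $IJ=0$ implies $I=0$ or $J=0$; and $E$ is downward directed (condition (MT3)) if for all $u,v\in E^0$ there is $w\in E^0$ such that there are directed paths (possibly of length zero) from $u$ to $w$ and from $v$ to $w$.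 -/

import Mathlib

universe u v w

/-- An associative ring, not necessarily with a unit, is *prime* if `0` is a prime ideal: the ring
is nonzero, and `I J = 0` implies `I = 0` or `J = 0` for two-sided ideals `I`, `J`. -/
def IsPrimeNonUnitalRing (A : Type u) [NonUnitalRing A] : Prop :=
  Nontrivial A ∧
    ∀ I J : TwoSidedIdeal A, (∀ a ∈ I, ∀ b ∈ J, a * b = 0) → I = ⊥ ∨ J = ⊥

/-- `Reaches a b` is the relation `a ≥ b`: there is a directed path, possibly empty, from `a`
to `b`. -/
def Reaches {V : Type u} [Quiver.{v} V] (a b : V) : Prop :=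
  Nonempty (Quiver.Path a b)

/-- Condition (MT3): any two vertices have a common lower bound for `≥`. -/
def IsDownwardDirected (V : Type u) [Quiver.{v} V] : Prop :=
  ∀ a b : V, ∃ c : V, Reaches a c ∧ Reaches b c

namespace Leavitt

/-- Generators of the Leavitt path algebra of the directed graph with vertex set `V` and edge set
`Quiver.Total V` (an edge `e` has source `e.left` and range `e.right`): the vertices `v`, the
edges `e`, and the ghost edges `e*`. -/
inductive Generator (V : Type u) [Quiver.{v} V] : Type (max u v)
  | vertex (a : V) : Generator V
  | edge (e : Quiver.Total V) : Generator V
  | ghost (e : Quiver.Total V) : Generator V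

/-- The free associative, not necessarily unital, `R`-algebra on the generators. -/
abbrev Free (R : Type w) (V : Type u) [CommRing R] [Quiver.{v} V] : Type (max u v w) :=
  MonoidAlgebra R (FreeSemigroup (Generator V))

section

variable (R : Type w) {V : Type u} [CommRing R] [Quiver.{v} V]

/-- A generator as an element of the free algebra. -/
noncomputable def gen (x : Generator V) : Free R V :=
  MonoidAlgebra.single (FreeSemigroup.of x) 1

/-- The defining relations of the Leavitt path algebra. -/
inductive Rel : Free R V → Free R V → Prop
  | vertex_idem (a : V) :
      Rel (gen R (.vertex a) * gen R (.vertex a)) (gen R (.vertex a))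
  | vertex_orth (a b : V) (h : a ≠ b) :
      Rel (gen R (.vertex a) * gen R (.vertex b)) 0
  | source_edge (e : Quiver.Total V) :
      Rel (gen R (.vertex e.left) * gen R (.edge e)) (gen R (.edge e))
  | edge_range (e : Quiver.Total V) :
      Rel (gen R (.edge e) * gen R (.vertex e.right)) (gen R (.edge e))
  | range_ghost (e : Quiver.Total V) :
      Rel (gen R (.vertex e.right) * gen R (.ghost e)) (gen R (.ghost e))
  | ghost_source (e : Quiver.Total V) :
      Rel (gen R (.ghost e) * gen R (.vertex e.left)) (gen R (.ghost e))
  | ghost_edge_self (e : Quiver.Total V) :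
      Rel (gen R (.ghost e) * gen R (.edge e)) (gen R (.vertex e.right))
  | ghost_edge_ne (e f : Quiver.Total V) (h : e ≠ f) :
      Rel (gen R (.ghost e) * gen R (.edge f)) 0
  | vertex_sum (a : V) (hfin : {e : Quiver.Total V | e.left = a}.Finite)
      (hne : {e : Quiver.Total V | e.left = a}.Nonempty) :
      Rel (gen R (.vertex a)) (∑ e ∈ hfin.toFinset, gen R (.edge e) * gen R (.ghost e))

variable (V) in
/-- The congruence generated by the relations. All scalar multiples of the relations are imposed,
so that the quotient is the quotient as an `R`-algebra (there is no unit to absorb scalars). -/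
noncomputable def con : RingCon (Free R V) :=
  ringConGen fun x y => ∃ (r : R) (x₀ y₀ : Free R V), Rel R x₀ y₀ ∧ x = r • x₀ ∧ y = r • y₀

theorem con_smul (r : R) {x y : Free R V} (h : con R V x y) : con R V (r • x) (r • y) := by
  change RingConGen.Rel _ _ _ at h
  change RingConGen.Rel _ _ _
  induction h with
  | of x y h =>
    obtain ⟨s, x₀, y₀, h, rfl, rfl⟩ := h
    exact .of _ _ ⟨r * s, x₀, y₀, h, (mul_smul r s x₀).symm, (mul_smul r s y₀).symm⟩
  | refl x => exact .refl _
  | symm _ ih => exact .symm ih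
  | trans _ _ ih₁ ih₂ => exact .trans ih₁ ih₂
  | add _ _ ih₁ ih₂ => simpa only [smul_add] using RingConGen.Rel.add ih₁ ih₂
  | mul _ h₂ ih₁ _ => simpa only [smul_mul_assoc] using RingConGen.Rel.mul ih₁ h₂

end

end Leavitt

/-- The Leavitt path algebra `L_R(E)` of the directed graph `E` with vertex set `V`. -/
def LeavittPathAlgebra (R : Type w) (V : Type u) [CommRing R] [Quiver.{v} V] :
    Type (max u v w) :=
  (Leavitt.con R V).Quotient

namespace LeavittPathAlgebra

variable (R : Type w) (V : Type u) [CommRing R] [Quiver.{v} V]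

noncomputable instance : NonUnitalRing (LeavittPathAlgebra R V) :=
  inferInstanceAs (NonUnitalRing (Leavitt.con R V).Quotient)

noncomputable instance : SMul R (LeavittPathAlgebra R V) where
  smul r := Quotient.map' (r • ·) fun _ _ h => Leavitt.con_smul R r h

noncomputable instance : Module R (LeavittPathAlgebra R V) where
  one_smul := by rintro ⟨x⟩; exact congrArg (Quot.mk _) (one_smul R x)
  mul_smul r s := by rintro ⟨x⟩; exact congrArg (Quot.mk _) (mul_smul r s x)
  smul_zero r := congrArg (Quot.mk _) (smul_zero r)
  smul_add r := by rintro ⟨x⟩ ⟨y⟩; exact congrArg (Quot.mk _) (smul_add r x y)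
  add_smul r s := by rintro ⟨x⟩; exact congrArg (Quot.mk _) (add_smul r s x)
  zero_smul := by rintro ⟨x⟩; exact congrArg (Quot.mk _) (zero_smul R x)

instance : IsScalarTower R (LeavittPathAlgebra R V) (LeavittPathAlgebra R V) where
  smul_assoc r := by rintro ⟨x⟩ ⟨y⟩; exact congrArg (Quot.mk _) (smul_mul_assoc r x y)

instance : SMulCommClass R (LeavittPathAlgebra R V) (LeavittPathAlgebra R V) where
  smul_comm r := by rintro ⟨x⟩ ⟨y⟩; exact congrArg (Quot.mk _) (mul_smul_comm r x y).symm

end LeavittPathAlgebra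

/-!
# Prime Leavitt path algebras

The argument rests on elements of the form `r a + y`, where `a` is a vertex, `r ≠ 0` is
a scalar and `y` is a combination of paths of positive length.

Such an element is never zero (`smul_vertex_add_ne_zero`). To see this, let the algebra act on
functions on the points of a branching system, where each point carries an integer degree that the
edges raise by one: in degree zero only the term `r a` is visible. Branching systems exist for
reasons of cardinality: if `K` is infinite and at least as large as the set of edges, then `K` is in
bijection with `S × K` for every nonempty set `S` of edges (`nonempty_branchingSystem`). Keeping
track of degrees inside the representation takes the place of the grading of the algebra, and no
special treatment of cycles without exits is needed.

Every nonzero ideal contains such an element (`exists_smul_vertex_add_mem`). A nonzero element can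
be multiplied from the right into a nonzero combination of paths, by stripping ghost edges one at a
time (`exists_mul_mem_pathsGE`), and a nonzero combination of paths is brought into the form
`r a + y` by cancelling one of its shortest paths from the left
(`exists_mul_mul_vertex_of_mem_pathsLT`).

If an ideal contains `r a + y` and there is a path `p` from `a` to `c`, then conjugating by `p`
gives an element `r c + y'` of the ideal (`exists_smul_vertex_add_mem_of_path`). So if the graph is
downward directed, two nonzero ideals contain elements `r c + y` and `s c + z` at the same vertex
`c`; their product is `r s c` plus paths of positive length, which is nonzero over a domain.

Conversely, in a prime algebra nothing but zero is annihilated by a nonzero ideal. If `r s = 0`, the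
ideal of elements killed by `r` contains `s a` and annihilates `r a`. If `a` and `b` have no common
lower bound, then `a x b = 0` for every `x`, as one sees on monomials `p q*`
(`vertex_mul_mul_vertex_eq_zero`), and the ideal of those `x` with `x y b = 0` for all `y` contains
`a` and annihilates `b`.
-/

namespace LeavittPathAlgebra

open Leavitt

/-! ### Generators, relations and the universal property -/

section Basic

variable (R : Type w) {V : Type u} [CommRing R] [Quiver.{v} V]

/-- The class in the Leavitt path algebra of an element of the free algebra. -/
noncomputable def mk (x : Free R V) : LeavittPathAlgebra R V :=
  (con R V).toQuotient x

/-- The vertex `a` as an idempotent of the Leavitt path algebra. -/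
noncomputable def vertex (a : V) : LeavittPathAlgebra R V := mk R (gen R (.vertex a))

/-- The edge `e` as an element of the Leavitt path algebra. -/
noncomputable def edge (e : Quiver.Total V) : LeavittPathAlgebra R V := mk R (gen R (.edge e))

/-- The ghost edge `e*` as an element of the Leavitt path algebra. -/
noncomputable def ghost (e : Quiver.Total V) : LeavittPathAlgebra R V := mk R (gen R (.ghost e))

theorem mk_surjective : Function.Surjective (mk R (V := V)) := by
  rintro ⟨x⟩
  exact ⟨x, rfl⟩

theorem mk_eq_of_rel {x y : Free R V} (h : Rel R x y) : mk R x = mk R y :=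
  (RingCon.eq _).2 (RingConGen.Rel.of _ _ ⟨1, x, y, h, (one_smul R x).symm, (one_smul R y).symm⟩)

theorem mk_mul (x y : Free R V) : mk R (x * y) = mk R x * mk R y := rfl

theorem mk_add (x y : Free R V) : mk R (x + y) = mk R x + mk R y := rfl

theorem mk_smul (r : R) (x : Free R V) : mk R (r • x) = r • mk R x := rfl

theorem mk_zero : mk R (0 : Free R V) = 0 := rfl

theorem mk_sum {ι : Type*} (s : Finset ι) (f : ι → Free R V) :
    mk R (∑ i ∈ s, f i) = ∑ i ∈ s, mk R (f i) :=
  map_sum (⟨⟨mk R, mk_zero R⟩, mk_add R⟩ : Free R V →+ LeavittPathAlgebra R V) f s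

theorem vertex_mul_self (a : V) : vertex R a * vertex R a = vertex R a :=
  mk_eq_of_rel R (.vertex_idem a)

theorem vertex_mul_of_ne {a b : V} (h : a ≠ b) : vertex R a * vertex R b = 0 :=
  mk_eq_of_rel R (.vertex_orth a b h)

theorem left_mul_edge (e : Quiver.Total V) : vertex R e.left * edge R e = edge R e :=
  mk_eq_of_rel R (.source_edge e)

theorem edge_mul_right (e : Quiver.Total V) : edge R e * vertex R e.right = edge R e :=
  mk_eq_of_rel R (.edge_range e)

theorem right_mul_ghost (e : Quiver.Total V) : vertex R e.right * ghost R e = ghost R e :=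
  mk_eq_of_rel R (.range_ghost e)

theorem ghost_mul_left (e : Quiver.Total V) : ghost R e * vertex R e.left = ghost R e :=
  mk_eq_of_rel R (.ghost_source e)

theorem ghost_mul_edge_self (e : Quiver.Total V) : ghost R e * edge R e = vertex R e.right :=
  mk_eq_of_rel R (.ghost_edge_self e)

theorem ghost_mul_edge_of_ne {e f : Quiver.Total V} (h : e ≠ f) : ghost R e * edge R f = 0 :=
  mk_eq_of_rel R (.ghost_edge_ne e f h)

theorem vertex_eq_sum (a : V) (hfin : {e : Quiver.Total V | e.left = a}.Finite)
    (hne : {e : Quiver.Total V | e.left = a}.Nonempty) :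
    vertex R a = ∑ e ∈ hfin.toFinset, edge R e * ghost R e :=
  (mk_eq_of_rel R (.vertex_sum a hfin hne)).trans (mk_sum R _ _)

theorem vertex_mul_edge_of_ne {a : V} {e : Quiver.Total V} (h : a ≠ e.left) :
    vertex R a * edge R e = 0 := by
  rw [← left_mul_edge, ← mul_assoc, vertex_mul_of_ne R h, zero_mul]

theorem ghost_mul_vertex_of_ne {a : V} {e : Quiver.Total V} (h : e.left ≠ a) :
    ghost R e * vertex R a = 0 := by
  rw [← ghost_mul_left, mul_assoc, vertex_mul_of_ne R h, mul_zero]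

/-- An algebra homomorphism on the free algebra that respects the defining relations descends to
the Leavitt path algebra. -/
noncomputable def lift {A : Type*} [NonUnitalRing A] [Module R A] (F : Free R V →ₙₐ[R] A)
    (h : ∀ x y, Rel R x y → F x = F y) : LeavittPathAlgebra R V →ₙₐ[R] A where
  toFun := Quotient.lift F <| by
    intro x y hxy
    change RingConGen.Rel _ _ _ at hxy
    induction hxy with
    | of x y hr =>
      obtain ⟨r, x₀, y₀, hr, rfl, rfl⟩ := hr
      rw [map_smul, map_smul, h _ _ hr]
    | refl => rfl
    | symm _ ih => exact ih.symm
    | trans _ _ ih₁ ih₂ => exact ih₁.trans ih₂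
    | add _ _ ih₁ ih₂ => rw [map_add, map_add, ih₁, ih₂]
    | mul _ _ ih₁ ih₂ => rw [map_mul, map_mul, ih₁, ih₂]
  map_smul' r := by rintro ⟨x⟩; exact map_smul F r x
  map_zero' := map_zero F
  map_add' := by rintro ⟨x⟩ ⟨y⟩; exact map_add F x y
  map_mul' := by rintro ⟨x⟩ ⟨y⟩; exact map_mul F x y

end Basic

/-! ### Branching systems and their representations -/

/-- A branching system: a set `K` of points attached to every vertex, and for each edge `e` an
injection `cons e` from the points at `e.right` to the points at `e.left`, such that the points at
a vertex that is not a sink are the disjoint union of the images of `cons e` over the edges `e`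
leaving it. A point `k` at `a` with `head a k = some e` has the form `cons e (tail a k)`, and
`head a k = none` only when `a` is a sink. -/
structure BranchingSystem (V : Type u) [Quiver.{v} V] where
  /-- The set of points attached to each vertex. -/
  K : Type (max u v)
  /-- The embedding of the points at `e.right` into those at `e.left`. -/
  cons : Quiver.Total V → K → K
  /-- The edge through which a given point at a given vertex factors. -/
  head : V → K → Option (Quiver.Total V)
  /-- The preimage of a point under the embedding of its head. -/
  tail : V → K → K
  /-- A chosen point, witnessing that `K` is nonempty. -/
  point : K
  head_cons (e : Quiver.Total V) (k : K) : head e.left (cons e k) = some e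
  tail_cons (e : Quiver.Total V) (k : K) : tail e.left (cons e k) = k
  left_of_head {a : V} {k : K} {e : Quiver.Total V} (h : head a k = some e) : e.left = a
  cons_tail {a : V} {k : K} {e : Quiver.Total V} (h : head a k = some e) : cons e (tail a k) = k
  exists_head (e : Quiver.Total V) (k : K) : ∃ f, head e.left k = some f

/-- Branching systems exist: an infinite set `K` of cardinality at least that of the edges is
equipotent with `S × K` for every nonempty set `S` of edges. -/
theorem nonempty_branchingSystem (V : Type u) [Quiver.{v} V] : Nonempty (BranchingSystem V) := by
  classical
  let K : Type (max u v) := ℕ ⊕ Quiver.Total V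
  have key : ∀ a : V, Nonempty {e : Quiver.Total V // e.left = a} →
      Nonempty ({e : Quiver.Total V // e.left = a} × K ≃ K) := by
    intro a ha
    rw [← Cardinal.eq, ← Cardinal.mul_def]
    refine Cardinal.mul_eq_right (Cardinal.aleph0_le_mk K) ?_ (Cardinal.mk_ne_zero _)
    exact (Cardinal.mk_subtype_le _).trans (Cardinal.mk_le_of_injective Sum.inr_injective)
  let φ : ∀ a : V, Nonempty {e : Quiver.Total V // e.left = a} →
      ({e : Quiver.Total V // e.left = a} × K ≃ K) := fun a ha => (key a ha).some
  have ne (e : Quiver.Total V) : Nonempty {f : Quiver.Total V // f.left = e.left} := ⟨⟨e, rfl⟩⟩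
  exact ⟨{
    K := K
    cons := fun e k => φ e.left (ne e) (⟨e, rfl⟩, k)
    head := fun a k => if h : Nonempty {e : Quiver.Total V // e.left = a} then
      some ((φ a h).symm k).1 else none
    tail := fun a k => if h : Nonempty {e : Quiver.Total V // e.left = a} then
      ((φ a h).symm k).2 else k
    point := Sum.inl 0
    head_cons := fun e k => by simp
    tail_cons := fun e k => by simp
    left_of_head := fun {a k e} h => by
      split_ifs at h with ha
      rw [← Option.some.inj h]
      exact ((φ a ha).symm k).1.2
    cons_tail := fun {a k e} h => by
      split_ifs at h with ha
      obtain rfl := Option.some.inj h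
      rw [dif_pos ha]
      generalize hx : (φ a ha).symm k = x
      obtain ⟨⟨f, rfl⟩, l⟩ := x
      exact ((φ _ ha).symm_apply_eq.1 hx).symm
    exists_head := fun e k => ⟨_, dif_pos (ne e)⟩ }⟩

namespace BranchingSystem

variable (R : Type w) {V : Type u} [CommRing R] [Quiver.{v} V] (B : BranchingSystem V)

/-- The space on which the Leavitt path algebra acts: functions on the points of the branching
system, each point carrying an integer degree. -/
abbrev Space : Type (max u v w) := V × B.K × ℤ → R

open Classical in
/-- The action of the generators: a vertex restricts a function to the points above it, an edge
transports a function along `cons e` while raising the degree by one, and a ghost edge pulls it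
back. -/
noncomputable def genOp : Generator V → Module.End R (B.Space R)
  | .vertex a =>
    { toFun := fun f x => if x.1 = a then f x else 0
      map_add' := fun f g => by ext x; simp only [Pi.add_apply]; split_ifs <;> simp
      map_smul' := fun r f => by ext x; simp }
  | .edge e =>
    { toFun := fun f x =>
        if B.head x.1 x.2.1 = some e then f (e.right, B.tail x.1 x.2.1, x.2.2 - 1) else 0
      map_add' := fun f g => by ext x; simp only [Pi.add_apply]; split_ifs <;> simp
      map_smul' := fun r f => by ext x; simp }
  | .ghost e =>
    { toFun := fun f x => if x.1 = e.right then f (e.left, B.cons e x.2.1, x.2.2 + 1) else 0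
      map_add' := fun f g => by ext x; simp only [Pi.add_apply]; split_ifs <;> simp
      map_smul' := fun r f => by ext x; simp }

open Classical in
theorem genOp_vertex_apply (a : V) (f : B.Space R) (x : V × B.K × ℤ) :
    B.genOp R (.vertex a) f x = if x.1 = a then f x else 0 := rfl

open Classical in
theorem genOp_edge_apply (e : Quiver.Total V) (f : B.Space R) (x : V × B.K × ℤ) :
    B.genOp R (.edge e) f x =
      if B.head x.1 x.2.1 = some e then f (e.right, B.tail x.1 x.2.1, x.2.2 - 1) else 0 := rfl

open Classical in
theorem genOp_ghost_apply (e : Quiver.Total V) (f : B.Space R) (x : V × B.K × ℤ) :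
    B.genOp R (.ghost e) f x =
      if x.1 = e.right then f (e.left, B.cons e x.2.1, x.2.2 + 1) else 0 := rfl

/-- The action of the free algebra extending `genOp`. -/
noncomputable def freeRep : Free R V →ₙₐ[R] Module.End R (B.Space R) :=
  MonoidAlgebra.liftMagma R (FreeSemigroup.lift (B.genOp R))

theorem freeRep_gen (x : Generator V) : B.freeRep R (gen R x) = B.genOp R x := by
  simp [freeRep, gen]

theorem genOp_edge_mul_ghost_apply (e : Quiver.Total V) (f : B.Space R) (x : V × B.K × ℤ)
    [Decidable (B.head x.1 x.2.1 = some e)] :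
    (B.genOp R (.edge e) * B.genOp R (.ghost e)) f x =
      if B.head x.1 x.2.1 = some e then f x else 0 := by
  rw [Module.End.mul_apply, genOp_edge_apply]
  split_ifs with h
  · obtain ⟨a, k, n⟩ := x
    simp [genOp_ghost_apply, B.cons_tail h, B.left_of_head h]
  · rfl

theorem freeRep_eq_of_rel (x y : Free R V) (h : Rel R x y) :
    B.freeRep R x = B.freeRep R y := by
  classical
  cases h with
  | vertex_idem a =>
    simp only [map_mul, freeRep_gen]
    ext f x
    simp only [Module.End.mul_apply, genOp_vertex_apply]
    split_ifs <;> rfl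
  | vertex_orth a b h =>
    simp only [map_mul, map_zero, freeRep_gen]
    ext f x
    simp only [Module.End.mul_apply, genOp_vertex_apply]
    split_ifs with h₁ h₂
    · exact absurd (h₁.symm.trans h₂) h
    all_goals rfl
  | source_edge e =>
    simp only [map_mul, freeRep_gen]
    ext f x
    simp only [Module.End.mul_apply, genOp_vertex_apply, genOp_edge_apply]
    split_ifs with h₁ h₂ h₂
    · rfl
    · rfl
    · exact absurd (B.left_of_head h₂).symm h₁
    · rfl
  | edge_range e =>
    simp only [map_mul, freeRep_gen]
    ext f x
    simp [Module.End.mul_apply, genOp_vertex_apply, genOp_edge_apply]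
  | range_ghost e =>
    simp only [map_mul, freeRep_gen]
    ext f x
    simp only [Module.End.mul_apply, genOp_vertex_apply, genOp_ghost_apply]
    split_ifs <;> rfl
  | ghost_source e =>
    simp only [map_mul, freeRep_gen]
    ext f x
    simp [Module.End.mul_apply, genOp_vertex_apply, genOp_ghost_apply]
  | ghost_edge_self e =>
    simp only [map_mul, freeRep_gen]
    ext f x
    simp only [Module.End.mul_apply, genOp_vertex_apply, genOp_ghost_apply, genOp_edge_apply,
      B.head_cons, B.tail_cons, if_true, add_sub_cancel_right]
    split_ifs with h
    · rw [← h]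
    · rfl
  | ghost_edge_ne e f h =>
    simp only [map_mul, map_zero, freeRep_gen]
    ext g x
    simp [Module.End.mul_apply, genOp_ghost_apply, genOp_edge_apply, B.head_cons, h]
  | vertex_sum a hfin hne =>
    simp only [map_sum, map_mul, freeRep_gen]
    ext f x
    rw [LinearMap.sum_apply, Finset.sum_apply]
    simp only [genOp_edge_mul_ghost_apply, genOp_vertex_apply]
    split_ifs with h
    · obtain ⟨e, rfl⟩ := hne
      obtain ⟨d, hd⟩ := B.exists_head e x.2.1
      have hd' := hd
      rw [← h] at hd'
      rw [Finset.sum_eq_single_of_mem d, if_pos hd']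
      · simpa using B.left_of_head hd
      · intro b _ hb
        rw [if_neg]
        rw [hd']
        simpa using hb.symm
    · refine (Finset.sum_eq_zero fun e he => if_neg fun h' => h ?_).symm
      rw [← B.left_of_head h']
      simpa using he

/-- The representation of the Leavitt path algebra attached to a branching system. -/
noncomputable def rep : LeavittPathAlgebra R V →ₙₐ[R] Module.End R (B.Space R) :=
  lift R (B.freeRep R) (B.freeRep_eq_of_rel R)

theorem rep_vertex (a : V) : B.rep R (vertex R a) = B.genOp R (.vertex a) := B.freeRep_gen R _

theorem rep_edge (e : Quiver.Total V) : B.rep R (edge R e) = B.genOp R (.edge e) :=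
  B.freeRep_gen R _

end BranchingSystem

/-! ### Monomials -/

section Monomials

variable (R : Type w) {V : Type u} [CommRing R] [Quiver.{v} V]

/-- `IsPathMonomial R n x` says that `x` is a product of `n` edges followed by a vertex. The edges
need not be composable; if they are not, then `x = 0`. -/
inductive IsPathMonomial : ℕ → LeavittPathAlgebra R V → Prop
  | of_vertex (a : V) : IsPathMonomial 0 (vertex R a)
  | edge_mul (e : Quiver.Total V) {n : ℕ} {x : LeavittPathAlgebra R V} (h : IsPathMonomial n x) :
      IsPathMonomial (n + 1) (edge R e * x)

/-- `IsMonomial R n x` says that `x` is a path monomial followed by `n` ghost edges. -/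
inductive IsMonomial : ℕ → LeavittPathAlgebra R V → Prop
  | of_path {n : ℕ} {x : LeavittPathAlgebra R V} (h : IsPathMonomial R n x) : IsMonomial 0 x
  | mul_ghost {n : ℕ} {x : LeavittPathAlgebra R V} (h : IsMonomial n x) (e : Quiver.Total V) :
      IsMonomial (n + 1) (x * ghost R e)

variable (V)

/-- The span of the path monomials of length at least `n`. -/
noncomputable def pathsGE (n : ℕ) : Submodule R (LeavittPathAlgebra R V) :=
  Submodule.span R {x | ∃ m, n ≤ m ∧ IsPathMonomial R m x}

/-- The span of the path monomials of length less than `n`. -/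
noncomputable def pathsLT (n : ℕ) : Submodule R (LeavittPathAlgebra R V) :=
  Submodule.span R {x | ∃ m, m < n ∧ IsPathMonomial R m x}

/-- The span of the monomials with fewer than `n` ghost edges. -/
noncomputable def ghostsLT (n : ℕ) : Submodule R (LeavittPathAlgebra R V) :=
  Submodule.span R {x | ∃ m, m < n ∧ IsMonomial R m x}

variable {V}

theorem vertex_mul_vertex (a b : V) :
    vertex R a * vertex R b = 0 ∨ vertex R a * vertex R b = vertex R b := by
  by_cases h : a = b
  · subst h; exact .inr (vertex_mul_self R a)
  · exact .inl (vertex_mul_of_ne R h)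

variable {R}

theorem mul_left_mem_span {s : Set (LeavittPathAlgebra R V)} (a : LeavittPathAlgebra R V)
    {N : Submodule R (LeavittPathAlgebra R V)} (h : ∀ x ∈ s, a * x ∈ N)
    {x : LeavittPathAlgebra R V} (hx : x ∈ Submodule.span R s) : a * x ∈ N := by
  induction hx using Submodule.span_induction with
  | mem x hx => exact h x hx
  | zero => rw [mul_zero]; exact N.zero_mem
  | add x y _ _ hx hy => rw [mul_add]; exact N.add_mem hx hy
  | smul r x _ hx => rw [mul_smul_comm]; exact N.smul_mem r hx

theorem mul_right_mem_span {s : Set (LeavittPathAlgebra R V)} (a : LeavittPathAlgebra R V)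
    {N : Submodule R (LeavittPathAlgebra R V)} (h : ∀ x ∈ s, x * a ∈ N)
    {x : LeavittPathAlgebra R V} (hx : x ∈ Submodule.span R s) : x * a ∈ N := by
  induction hx using Submodule.span_induction with
  | mem x hx => exact h x hx
  | zero => rw [zero_mul]; exact N.zero_mem
  | add x y _ _ hx hy => rw [add_mul]; exact N.add_mem hx hy
  | smul r x _ hx => rw [smul_mul_assoc]; exact N.smul_mem r hx

theorem IsPathMonomial.vertex_mul {n : ℕ} {x : LeavittPathAlgebra R V} (h : IsPathMonomial R n x)
    (a : V) : vertex R a * x = 0 ∨ vertex R a * x = x := by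
  cases h with
  | of_vertex b => exact vertex_mul_vertex R a b
  | edge_mul e h =>
    by_cases ha : a = e.left
    · right; rw [ha, ← mul_assoc, left_mul_edge]
    · left; rw [← mul_assoc, vertex_mul_edge_of_ne R ha, zero_mul]

theorem IsPathMonomial.mul_vertex {n : ℕ} {x : LeavittPathAlgebra R V} (h : IsPathMonomial R n x)
    (a : V) : x * vertex R a = 0 ∨ x * vertex R a = x := by
  induction h with
  | of_vertex b =>
    by_cases hb : b = a
    · subst hb; exact .inr (vertex_mul_self R b)
    · exact .inl (vertex_mul_of_ne R hb)
  | edge_mul e h ih =>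
    rw [mul_assoc]
    exact ih.imp (fun h => by rw [h, mul_zero]) (fun h => by rw [h])

theorem IsPathMonomial.mul_edge {n : ℕ} {x : LeavittPathAlgebra R V} (h : IsPathMonomial R n x)
    (f : Quiver.Total V) : x * edge R f = 0 ∨ IsPathMonomial R (n + 1) (x * edge R f) := by
  induction h with
  | of_vertex b =>
    by_cases hb : b = f.left
    · right
      rw [hb, left_mul_edge, ← edge_mul_right]
      exact .edge_mul f (.of_vertex _)
    · exact .inl (vertex_mul_edge_of_ne R hb)
  | edge_mul e h ih =>
    rw [mul_assoc]
    exact ih.imp (fun h => by rw [h, mul_zero]) (fun h => .edge_mul e h)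

theorem IsPathMonomial.mem_pathsGE {m n : ℕ} {x : LeavittPathAlgebra R V}
    (h : IsPathMonomial R m x) (hn : n ≤ m) : x ∈ pathsGE R V n :=
  Submodule.subset_span ⟨m, hn, h⟩

theorem pathsGE_anti {m n : ℕ} (h : m ≤ n) : pathsGE R V n ≤ pathsGE R V m :=
  Submodule.span_mono fun _ ⟨k, hk, hx⟩ => ⟨k, h.trans hk, hx⟩

theorem pathsLT_le_pathsGE_zero (n : ℕ) : pathsLT R V n ≤ pathsGE R V 0 :=
  Submodule.span_mono fun _ ⟨k, _, hx⟩ => ⟨k, k.zero_le, hx⟩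

theorem vertex_mul_mem_pathsGE {n : ℕ} {x : LeavittPathAlgebra R V} (a : V)
    (hx : x ∈ pathsGE R V n) : vertex R a * x ∈ pathsGE R V n := by
  refine mul_left_mem_span _ ?_ hx
  rintro x ⟨m, hm, hx⟩
  obtain h | h := hx.vertex_mul a
  · rw [h]; exact Submodule.zero_mem _
  · rw [h]; exact hx.mem_pathsGE hm

theorem vertex_mul_mem_pathsLT {n : ℕ} {x : LeavittPathAlgebra R V} (a : V)
    (hx : x ∈ pathsLT R V n) : vertex R a * x ∈ pathsLT R V n := by
  refine mul_left_mem_span _ ?_ hx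
  rintro x ⟨m, hm, hx⟩
  obtain h | h := hx.vertex_mul a
  · rw [h]; exact Submodule.zero_mem _
  · rw [h]; exact Submodule.subset_span ⟨m, hm, hx⟩

theorem mul_vertex_mem_pathsGE {n : ℕ} {x : LeavittPathAlgebra R V} (a : V)
    (hx : x ∈ pathsGE R V n) : x * vertex R a ∈ pathsGE R V n := by
  refine mul_right_mem_span _ ?_ hx
  rintro x ⟨m, hm, hx⟩
  obtain h | h := hx.mul_vertex a
  · rw [h]; exact Submodule.zero_mem _
  · rw [h]; exact hx.mem_pathsGE hm

theorem edge_mul_mem_pathsGE {n : ℕ} {x : LeavittPathAlgebra R V} (e : Quiver.Total V)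
    (hx : x ∈ pathsGE R V n) : edge R e * x ∈ pathsGE R V (n + 1) := by
  refine mul_left_mem_span _ ?_ hx
  rintro x ⟨m, hm, hx⟩
  exact (IsPathMonomial.edge_mul e hx).mem_pathsGE (by omega)

theorem mul_edge_mem_pathsGE {n : ℕ} {x : LeavittPathAlgebra R V} (e : Quiver.Total V)
    (hx : x ∈ pathsGE R V n) : x * edge R e ∈ pathsGE R V (n + 1) := by
  refine mul_right_mem_span _ ?_ hx
  rintro x ⟨m, hm, hx⟩
  obtain h | h := hx.mul_edge e
  · rw [h]; exact Submodule.zero_mem _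
  · exact h.mem_pathsGE (by omega)

theorem ghost_mul_mem_pathsGE {n : ℕ} {x : LeavittPathAlgebra R V} (e : Quiver.Total V)
    (hx : x ∈ pathsGE R V (n + 1)) : ghost R e * x ∈ pathsGE R V n := by
  refine mul_left_mem_span _ ?_ hx
  rintro x ⟨m, hm, hx⟩
  cases hx with
  | of_vertex a => omega
  | @edge_mul f m x hx =>
    rw [← mul_assoc]
    by_cases h : e = f
    · rw [← h, ghost_mul_edge_self]
      exact vertex_mul_mem_pathsGE _ (hx.mem_pathsGE (by omega))
    · rw [ghost_mul_edge_of_ne R h, zero_mul]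
      exact Submodule.zero_mem _

theorem mul_mem_pathsGE_one {x y : LeavittPathAlgebra R V}
    (hx : x ∈ pathsGE R V 1) (hy : y ∈ pathsGE R V 1) : x * y ∈ pathsGE R V 1 := by
  refine mul_right_mem_span _ ?_ hx
  rintro x ⟨m, hm, hx⟩
  have key : ∀ {m : ℕ} {x : LeavittPathAlgebra R V}, IsPathMonomial R m x →
      x * y ∈ pathsGE R V 1 := by
    intro m x hx
    induction hx with
    | of_vertex a => exact vertex_mul_mem_pathsGE a hy
    | edge_mul e _ ih =>
      rw [mul_assoc]
      exact pathsGE_anti (by omega) (edge_mul_mem_pathsGE e ih)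
  exact key hx

/-! ### Independence of a vertex from the longer paths -/

/-- Path monomials of length at least `n` raise the degree of a function by at least `n`. -/
theorem rep_apply_eq_zero (B : BranchingSystem V) {n : ℕ} {x : LeavittPathAlgebra R V}
    (hx : x ∈ pathsGE R V n) (f : B.Space R) (hf : ∀ a k (d : ℤ), d < 0 → f (a, k, d) = 0)
    (a : V) (k : B.K) (d : ℤ) (hd : d < n) : B.rep R x f (a, k, d) = 0 := by
  have key : ∀ {m : ℕ} {x : LeavittPathAlgebra R V}, IsPathMonomial R m x →
      ∀ a k (d : ℤ), d < m → B.rep R x f (a, k, d) = 0 := by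
    intro m x hx
    induction hx with
    | of_vertex b =>
      intro a k d hd
      rw [B.rep_vertex R, B.genOp_vertex_apply R]
      split_ifs
      · exact hf _ _ _ (by simpa using hd)
      · rfl
    | edge_mul e hx ih =>
      intro a k d hd
      rw [map_mul, Module.End.mul_apply, B.rep_edge R, B.genOp_edge_apply R]
      split_ifs
      · exact ih _ _ _ (by push_cast at hd; linarith)
      · rfl
  induction hx using Submodule.span_induction with
  | mem x hx =>
    obtain ⟨m, hm, hx⟩ := hx
    exact key hx a k d (hd.trans_le (by exact_mod_cast hm))
  | zero => simp
  | add x y _ _ hx hy => simp [hx, hy]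
  | smul r x _ hx => simp [hx]

theorem smul_vertex_add_ne_zero {r : R} (hr : r ≠ 0) (a : V) {y : LeavittPathAlgebra R V}
    (hy : y ∈ pathsGE R V 1) : r • vertex R a + y ≠ 0 := by
  intro h
  obtain ⟨B⟩ := nonempty_branchingSystem V
  -- In degree `0`, the indicator function of degree `0` only sees the vertex term.
  let f : B.Space R := fun x => if x.2.2 = 0 then 1 else 0
  have hf : ∀ a k (d : ℤ), d < 0 → f (a, k, d) = 0 := fun a k d hd => if_neg hd.ne
  have h₀ := rep_apply_eq_zero B hy f hf a B.point 0 (by norm_num)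
  have h₁ : B.rep R (r • vertex R a + y) f (a, B.point, 0) = 0 := by simp [h]
  apply hr
  simpa [h₀, B.rep_vertex R, B.genOp_vertex_apply R, f] using h₁

theorem smul_vertex_ne_zero {r : R} (hr : r ≠ 0) (a : V) : r • vertex R a ≠ 0 := by
  simpa using smul_vertex_add_ne_zero hr a (Submodule.zero_mem (pathsGE R V 1))

/-! ### Reduction to a vertex plus longer paths -/

theorem exists_eq_sum_of_mem_pathsLT {n : ℕ} {x : LeavittPathAlgebra R V}
    (hx : x ∈ pathsLT R V (n + 1)) :
    ∃ (c : V →₀ R) (Y : Quiver.Total V →₀ LeavittPathAlgebra R V),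
      (∀ e, Y e ∈ pathsLT R V n) ∧
        x = c.sum (fun a r => r • vertex R a) + Y.sum (fun e y => edge R e * y) := by
  classical
  induction hx using Submodule.span_induction with
  | mem x hx =>
    obtain ⟨m, hm, hx⟩ := hx
    cases hx with
    | of_vertex a => exact ⟨Finsupp.single a 1, 0, fun e => Submodule.zero_mem _, by simp⟩
    | @edge_mul e m y hy =>
      refine ⟨0, Finsupp.single e y, fun f => ?_, by simp⟩
      rw [Finsupp.single_apply]
      split_ifs
      · exact Submodule.subset_span ⟨m, by omega, hy⟩
      · exact Submodule.zero_mem _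
  | zero => exact ⟨0, 0, fun e => Submodule.zero_mem _, by simp⟩
  | add x y _ _ hx hy =>
    obtain ⟨c, Y, hY, rfl⟩ := hx
    obtain ⟨d, Z, hZ, rfl⟩ := hy
    refine ⟨c + d, Y + Z, fun e => Submodule.add_mem _ (hY e) (hZ e), ?_⟩
    rw [Finsupp.sum_add_index' (by simp) (by simp [add_smul]),
      Finsupp.sum_add_index' (by simp) (by simp [mul_add])]
    abel
  | smul r x _ hx =>
    obtain ⟨c, Y, hY, rfl⟩ := hx
    refine ⟨r • c, r • Y, fun e => Submodule.smul_mem _ r (hY e), ?_⟩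
    rw [Finsupp.sum_smul_index' (by simp), Finsupp.sum_smul_index' (by simp), smul_add,
      Finsupp.smul_sum, Finsupp.smul_sum]
    simp [mul_smul, mul_smul_comm]

/-- A nonzero combination of paths can be multiplied into a nonzero multiple of a vertex plus
longer paths: cancel a shortest path in its support from the left. -/
theorem exists_mul_mul_vertex_of_mem_pathsLT {n : ℕ} {x : LeavittPathAlgebra R V}
    (hx : x ∈ pathsLT R V n) (h0 : x ≠ 0) :
    ∃ (b : LeavittPathAlgebra R V) (a : V) (r : R) (y : LeavittPathAlgebra R V),
      r ≠ 0 ∧ y ∈ pathsGE R V 1 ∧ b * x * vertex R a = r • vertex R a + y := by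
  induction n generalizing x with
  | zero => simp [pathsLT] at hx; exact absurd hx h0
  | succ n ih =>
    obtain ⟨c, Y, hY, hsum⟩ := exists_eq_sum_of_mem_pathsLT hx
    by_cases hc : c = 0
    · have key (e : Quiver.Total V) : ghost R e * x = vertex R e.right * Y e := by
        rw [hsum, hc, Finsupp.sum_zero_index, zero_add, Finsupp.mul_sum,
          Finsupp.sum_eq_single e]
        · rw [← mul_assoc, ghost_mul_edge_self]
        · intro f _ hf
          rw [← mul_assoc, ghost_mul_edge_of_ne R hf.symm, zero_mul]
        · simp
      obtain ⟨e, he⟩ : ∃ e, ghost R e * x ≠ 0 := by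
        by_contra! hall
        apply h0
        rw [hsum, hc, Finsupp.sum_zero_index, zero_add]
        refine Finset.sum_eq_zero fun e _ => ?_
        change edge R e * Y e = 0
        rw [← edge_mul_right, mul_assoc, ← key, hall, mul_zero]
      have hmem : ghost R e * x ∈ pathsLT R V n := by
        rw [key]
        exact vertex_mul_mem_pathsLT _ (hY e)
      obtain ⟨b, a, r, y, hr, hy, h⟩ := ih hmem he
      exact ⟨b * ghost R e, a, r, y, hr, hy, by rw [← h, mul_assoc b]⟩
    · obtain ⟨a, ha⟩ := Finsupp.ne_iff.1 hc
      refine ⟨vertex R a, a, c a, vertex R a * Y.sum (fun e y => edge R e * y) * vertex R a, ha,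
        mul_vertex_mem_pathsGE a (vertex_mul_mem_pathsGE a ?_), ?_⟩
      · exact Submodule.sum_mem _ fun e _ =>
          edge_mul_mem_pathsGE e (pathsLT_le_pathsGE_zero n (hY e))
      · rw [hsum, mul_add, add_mul, Finsupp.mul_sum, Finsupp.sum_eq_single a]
        · rw [mul_smul_comm, smul_mul_assoc, vertex_mul_self, vertex_mul_self]
        · intro b _ hb
          rw [mul_smul_comm, vertex_mul_of_ne R hb.symm, smul_zero]
        · simp

end Monomials

/-! ### Removing ghost edges -/

section Ghosts

variable {R : Type w} {V : Type u} [CommRing R] [Quiver.{v} V]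

theorem IsMonomial.mul_vertex {n : ℕ} {x : LeavittPathAlgebra R V} (h : IsMonomial R n x)
    (a : V) : x * vertex R a = 0 ∨ x * vertex R a = x := by
  cases h with
  | of_path h => exact h.mul_vertex a
  | mul_ghost h e =>
    rw [mul_assoc]
    by_cases ha : e.left = a
    · right; rw [← ha, ghost_mul_left]
    · left; rw [ghost_mul_vertex_of_ne R ha, mul_zero]

theorem IsMonomial.mem_ghostsLT {m n : ℕ} {x : LeavittPathAlgebra R V} (h : IsMonomial R m x)
    (hm : m < n) : x ∈ ghostsLT R V n :=
  Submodule.subset_span ⟨m, hm, h⟩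

theorem ghostsLT_mono {m n : ℕ} (h : m ≤ n) : ghostsLT R V m ≤ ghostsLT R V n :=
  Submodule.span_mono fun _ ⟨k, hk, hx⟩ => ⟨k, hk.trans_le h, hx⟩

theorem pathsGE_zero_le_ghostsLT (n : ℕ) : pathsGE R V 0 ≤ ghostsLT R V (n + 1) :=
  Submodule.span_mono fun _ ⟨_, _, hx⟩ => ⟨0, n.succ_pos, .of_path hx⟩

theorem mul_vertex_mem_ghostsLT {n : ℕ} {x : LeavittPathAlgebra R V} (a : V)
    (hx : x ∈ ghostsLT R V n) : x * vertex R a ∈ ghostsLT R V n := by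
  refine mul_right_mem_span _ ?_ hx
  rintro x ⟨m, hm, hx⟩
  obtain h | h := hx.mul_vertex a
  · rw [h]; exact Submodule.zero_mem _
  · rw [h]; exact hx.mem_ghostsLT hm

theorem IsMonomial.mul_edge {n : ℕ} {x : LeavittPathAlgebra R V} (h : IsMonomial R n x)
    (f : Quiver.Total V) : x * edge R f = 0 ∨ ∃ m, IsMonomial R m (x * edge R f) := by
  cases h with
  | of_path h => exact (h.mul_edge f).imp_right fun h => ⟨0, .of_path h⟩
  | @mul_ghost n x h e =>
    rw [mul_assoc]
    by_cases hf : e = f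
    · rw [← hf, ghost_mul_edge_self]
      exact (h.mul_vertex _).imp_right fun h' => ⟨n, by rwa [h']⟩
    · left; rw [ghost_mul_edge_of_ne R hf, mul_zero]

variable (R V) in
/-- The monomials span the Leavitt path algebra, because their span contains the generators and is
stable under right multiplication by them. -/
theorem span_isMonomial :
    Submodule.span R {x : LeavittPathAlgebra R V | ∃ n, IsMonomial R n x} = ⊤ := by
  set S := Submodule.span R {x : LeavittPathAlgebra R V | ∃ n, IsMonomial R n x} with hS
  have hmul_gen (g : Generator V) {x} (hx : x ∈ S) : x * mk R (gen R g) ∈ S := by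
    refine mul_right_mem_span _ ?_ hx
    rintro x ⟨n, hx⟩
    cases g with
    | vertex a =>
      obtain h | h := hx.mul_vertex a
      · exact (congrArg (· ∈ S) h).mpr S.zero_mem
      · exact (congrArg (· ∈ S) h).mpr (Submodule.subset_span ⟨n, hx⟩)
    | edge e =>
      obtain h | h := hx.mul_edge e
      · exact (congrArg (· ∈ S) h).mpr S.zero_mem
      · exact Submodule.subset_span h
    | ghost e => exact Submodule.subset_span ⟨n + 1, hx.mul_ghost e⟩
  have hgen (g : Generator V) : mk R (gen R g) ∈ S := by
    refine Submodule.subset_span ?_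
    cases g with
    | vertex a => exact ⟨0, .of_path (.of_vertex a)⟩
    | edge e =>
      refine ⟨0, .of_path (n := 1) ?_⟩
      change IsPathMonomial R 1 (edge R e)
      rw [← edge_mul_right]
      exact .edge_mul e (.of_vertex _)
    | ghost e =>
      refine ⟨1, ?_⟩
      change IsMonomial R 1 (ghost R e)
      rw [← right_mul_ghost]
      exact .mul_ghost (.of_path (.of_vertex _)) e
  have hword (w : FreeSemigroup (Generator V)) :
      mk R (MonoidAlgebra.single w 1) ∈ S ∧ ∀ x ∈ S, x * mk R (MonoidAlgebra.single w 1) ∈ S := by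
    induction w using FreeSemigroup.recOnMul with
    | ih1 g => exact ⟨hgen g, fun x hx => hmul_gen g hx⟩
    | ih2 g w hg hw =>
      have h : (MonoidAlgebra.single (FreeSemigroup.of g * w) 1 : Free R V) =
          MonoidAlgebra.single (FreeSemigroup.of g) 1 * MonoidAlgebra.single w 1 := by
        rw [MonoidAlgebra.single_mul_single, one_mul]
      rw [h, mk_mul]
      refine ⟨hw.2 _ hg.1, fun x hx => ?_⟩
      rw [← mul_assoc]
      exact hw.2 _ (hg.2 x hx)
  refine eq_top_iff.2 fun x _ => ?_
  obtain ⟨x, rfl⟩ := mk_surjective R x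
  induction x using MonoidAlgebra.induction_linear with
  | zero => exact S.zero_mem
  | add x y hx hy => exact S.add_mem (hx trivial) (hy trivial)
  | single w r =>
    have h : (MonoidAlgebra.single w r : Free R V) = r • MonoidAlgebra.single w 1 := by simp
    rw [h, mk_smul]
    exact S.smul_mem r (hword w).1

theorem exists_mem_pathsLT {x : LeavittPathAlgebra R V} (hx : x ∈ pathsGE R V 0) :
    ∃ n, x ∈ pathsLT R V n := by
  have mono {m n : ℕ} (h : m ≤ n) : pathsLT R V m ≤ pathsLT R V n :=
    Submodule.span_mono fun _ ⟨k, hk, hx⟩ => ⟨k, hk.trans_le h, hx⟩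
  induction hx using Submodule.span_induction with
  | mem x hx => exact ⟨_, Submodule.subset_span ⟨hx.choose, Nat.lt_succ_self _, hx.choose_spec.2⟩⟩
  | zero => exact ⟨0, Submodule.zero_mem _⟩
  | add x y _ _ hx hy =>
    obtain ⟨m, hx⟩ := hx
    obtain ⟨n, hy⟩ := hy
    exact ⟨max m n, Submodule.add_mem _ (mono (le_max_left m n) hx) (mono (le_max_right m n) hy)⟩
  | smul r x _ hx =>
    obtain ⟨n, hx⟩ := hx
    exact ⟨n, Submodule.smul_mem _ r hx⟩

theorem exists_mem_ghostsLT (x : LeavittPathAlgebra R V) : ∃ n, x ∈ ghostsLT R V (n + 1) := by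
  have hx : x ∈ Submodule.span R {x : LeavittPathAlgebra R V | ∃ n, IsMonomial R n x} := by
    rw [span_isMonomial]; trivial
  induction hx using Submodule.span_induction with
  | mem x hx => exact ⟨_, hx.choose_spec.mem_ghostsLT (Nat.lt_succ_self _)⟩
  | zero => exact ⟨0, Submodule.zero_mem _⟩
  | add x y _ _ hx hy =>
    obtain ⟨m, hx⟩ := hx
    obtain ⟨n, hy⟩ := hy
    exact ⟨max m n, Submodule.add_mem _ (ghostsLT_mono (by simp) hx) (ghostsLT_mono (by simp) hy)⟩
  | smul r x _ hx =>
    obtain ⟨n, hx⟩ := hx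
    exact ⟨n, Submodule.smul_mem _ r hx⟩

theorem exists_mul_vertex_ne_zero {x : LeavittPathAlgebra R V} (hx : x ≠ 0) :
    ∃ a, x * vertex R a ≠ 0 := by
  classical
  have key (x : LeavittPathAlgebra R V) :
      ∃ Y : V →₀ LeavittPathAlgebra R V, x = Y.sum fun a y => y * vertex R a := by
    have hx : x ∈ Submodule.span R {x : LeavittPathAlgebra R V | ∃ n, IsMonomial R n x} := by
      rw [span_isMonomial]; trivial
    induction hx using Submodule.span_induction with
    | mem x hx =>
      have hpath : ∀ {n : ℕ} {x : LeavittPathAlgebra R V}, IsPathMonomial R n x →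
          ∃ a, x * vertex R a = x := by
        intro n x hx
        induction hx with
        | of_vertex a => exact ⟨a, vertex_mul_self R a⟩
        | edge_mul e _ ih => exact ih.imp fun a h => by rw [mul_assoc, h]
      obtain ⟨a, ha⟩ : ∃ a, x * vertex R a = x := by
        obtain ⟨n, hx⟩ := hx
        cases hx with
        | of_path h => exact hpath h
        | mul_ghost h e => exact ⟨e.left, by rw [mul_assoc, ghost_mul_left]⟩
      exact ⟨Finsupp.single a x, by simp [ha]⟩
    | zero => exact ⟨0, by simp⟩
    | add x y _ _ hx hy =>
      obtain ⟨Y, rfl⟩ := hx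
      obtain ⟨Z, rfl⟩ := hy
      exact ⟨Y + Z, by rw [Finsupp.sum_add_index' (by simp) (by simp [add_mul])]⟩
    | smul r x _ hx =>
      obtain ⟨Y, rfl⟩ := hx
      refine ⟨r • Y, ?_⟩
      rw [Finsupp.sum_smul_index' (by simp), Finsupp.smul_sum]
      simp [smul_mul_assoc]
  by_contra! hall
  apply hx
  obtain ⟨Y, hY⟩ := key x
  have h (a : V) : Y a * vertex R a = 0 := by
    rw [← hall a, hY, Finsupp.sum_mul, Finsupp.sum_eq_single a]
    · rw [mul_assoc, vertex_mul_self]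
    · intro b _ hb
      rw [mul_assoc, vertex_mul_of_ne R hb, mul_zero]
    · simp
  rw [hY]
  exact Finset.sum_eq_zero fun a _ => h a

theorem exists_eq_sum_of_mem_ghostsLT {n : ℕ} {x : LeavittPathAlgebra R V}
    (hx : x ∈ ghostsLT R V (n + 1)) :
    ∃ x₀ ∈ pathsGE R V 0, ∃ Y : Quiver.Total V →₀ LeavittPathAlgebra R V,
      (∀ e, Y e ∈ ghostsLT R V n) ∧ x = x₀ + Y.sum (fun e y => y * ghost R e) := by
  classical
  induction hx using Submodule.span_induction with
  | mem x hx =>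
    obtain ⟨m, hm, hx⟩ := hx
    cases hx with
    | of_path h =>
      exact ⟨x, h.mem_pathsGE (Nat.zero_le _), 0, fun e => Submodule.zero_mem _, by simp⟩
    | @mul_ghost m y hy e =>
      refine ⟨0, Submodule.zero_mem _, Finsupp.single e y, fun f => ?_, by simp⟩
      rw [Finsupp.single_apply]
      split_ifs
      · exact hy.mem_ghostsLT (by omega)
      · exact Submodule.zero_mem _
  | zero => exact ⟨0, Submodule.zero_mem _, 0, fun e => Submodule.zero_mem _, by simp⟩
  | add x y _ _ hx hy =>
    obtain ⟨x₀, hx₀, Y, hY, rfl⟩ := hx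
    obtain ⟨y₀, hy₀, Z, hZ, rfl⟩ := hy
    refine ⟨x₀ + y₀, Submodule.add_mem _ hx₀ hy₀, Y + Z,
      fun e => Submodule.add_mem _ (hY e) (hZ e), ?_⟩
    rw [Finsupp.sum_add_index' (by simp) (by simp [add_mul])]
    abel
  | smul r x _ hx =>
    obtain ⟨x₀, hx₀, Y, hY, rfl⟩ := hx
    refine ⟨r • x₀, Submodule.smul_mem _ r hx₀, r • Y,
      fun e => Submodule.smul_mem _ r (hY e), ?_⟩
    rw [Finsupp.sum_smul_index' (by simp), smul_add, Finsupp.smul_sum]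
    simp [smul_mul_assoc]

/-- Right multiplication by an edge is injective on the combinations of paths that end at the
source of that edge. -/
theorem mul_edge_ne_zero {x : LeavittPathAlgebra R V} (hx : x ∈ pathsGE R V 0)
    (f : Quiver.Total V) (h0 : x * vertex R f.left ≠ 0) : x * edge R f ≠ 0 := by
  intro h
  obtain ⟨n, hn⟩ := exists_mem_pathsLT (mul_vertex_mem_pathsGE f.left hx)
  obtain ⟨b, a, r, y, hr, hy, hb⟩ := exists_mul_mul_vertex_of_mem_pathsLT hn h0
  have ha : f.left = a := by
    by_contra hne
    apply smul_vertex_add_ne_zero hr a hy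
    rw [← hb, mul_assoc, mul_assoc, vertex_mul_of_ne R hne, mul_zero, mul_zero]
  subst ha
  have h₁ : ghost R f * (b * (x * vertex R f.left) * vertex R f.left) * edge R f = 0 := by
    simp only [mul_assoc, left_mul_edge, h, mul_zero]
  rw [hb, mul_add, add_mul, mul_smul_comm, smul_mul_assoc, ghost_mul_left,
    ghost_mul_edge_self] at h₁
  refine smul_vertex_add_ne_zero hr f.right ?_ h₁
  rw [mul_assoc]
  exact ghost_mul_mem_pathsGE f (mul_edge_mem_pathsGE f hy)

/-- Every nonzero element can be multiplied from the right into a nonzero combination of paths.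
If the element ends at a vertex `a`, one strips its ghost edges by multiplying with the edges
leaving `a`. This can only fail if it kills the element, which is impossible when `a` is regular
by the relation `a = ∑ e e*`, and when `a` is an infinite emitter because some edge leaving `a`
does not occur in the element. -/
theorem exists_mul_mem_pathsGE {n : ℕ} {x : LeavittPathAlgebra R V}
    (hx : x ∈ ghostsLT R V (n + 1)) (h0 : x ≠ 0) : ∃ b, x * b ∈ pathsGE R V 0 ∧ x * b ≠ 0 := by
  classical
  induction n generalizing x with
  | zero =>
    obtain ⟨x₀, hx₀, Y, hY, rfl⟩ := exists_eq_sum_of_mem_ghostsLT hx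
    have hY0 : Y = 0 := by
      ext e
      simpa [ghostsLT] using hY e
    subst hY0
    rw [Finsupp.sum_zero_index, add_zero] at h0 ⊢
    obtain ⟨a, ha⟩ := exists_mul_vertex_ne_zero h0
    exact ⟨vertex R a, mul_vertex_mem_pathsGE a hx₀, ha⟩
  | succ n ih =>
    obtain ⟨a, ha⟩ := exists_mul_vertex_ne_zero h0
    obtain ⟨x₀, hx₀, Y, hY, hsum⟩ := exists_eq_sum_of_mem_ghostsLT hx
    have hedge (f : Quiver.Total V) :
        x * edge R f = x₀ * edge R f + Y f * vertex R f.right := by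
      rw [hsum, add_mul, Finsupp.sum_mul, Finsupp.sum_eq_single f]
      · rw [mul_assoc (Y f), ghost_mul_edge_self]
      · intro e _ he
        rw [mul_assoc, ghost_mul_edge_of_ne R he, mul_zero]
      · simp
    have hvertex : x * vertex R a =
        x₀ * vertex R a + ∑ e ∈ Y.support, Y e * ghost R e * vertex R a := by
      rw [hsum, add_mul, Finsupp.sum_mul, Finsupp.sum]
    by_cases hall : ∃ f : Quiver.Total V, f.left = a ∧ x * edge R f ≠ 0
    · obtain ⟨f, -, hf⟩ := hall
      have hmem : x * edge R f ∈ ghostsLT R V (n + 1) := by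
        rw [hedge]
        exact Submodule.add_mem _
          (pathsGE_zero_le_ghostsLT n (pathsGE_anti (Nat.zero_le 1) (mul_edge_mem_pathsGE f hx₀)))
          (mul_vertex_mem_ghostsLT _ (hY f))
      obtain ⟨b, hb, hb0⟩ := ih hmem hf
      exact ⟨edge R f * b, by rwa [← mul_assoc], by rwa [← mul_assoc]⟩
    push Not at hall
    have hx₀a : x * vertex R a = x₀ * vertex R a ∨ x₀ * vertex R a = 0 := by
      obtain hne | hne := Set.eq_empty_or_nonempty {e : Quiver.Total V | e.left = a}
      · left
        rw [hvertex, add_eq_left]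
        refine Finset.sum_eq_zero fun e _ => ?_
        have he : e.left ≠ a := fun he => (Set.eq_empty_iff_forall_notMem.1 hne e) he
        rw [mul_assoc, ghost_mul_vertex_of_ne R he, mul_zero]
      · by_cases hfin : {e : Quiver.Total V | e.left = a}.Finite
        · exfalso
          apply ha
          rw [vertex_eq_sum R a hfin hne, Finset.mul_sum]
          refine Finset.sum_eq_zero fun e he => ?_
          rw [← mul_assoc, hall e (by simpa using he), zero_mul]
        · right
          obtain ⟨f, hfa, hfY⟩ := (Set.not_finite.1 hfin).exists_notMem_finset Y.support
          by_contra hne0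
          obtain rfl : f.left = a := hfa
          apply mul_edge_ne_zero hx₀ f hne0
          rw [← hall f rfl, hedge, Finsupp.notMem_support_iff.1 hfY, zero_mul, add_zero]
    obtain h | h := hx₀a
    · exact ⟨vertex R a, by rw [h]; exact mul_vertex_mem_pathsGE a hx₀, ha⟩
    · exfalso
      apply ha
      rw [hvertex, h, zero_add]
      refine Finset.sum_eq_zero fun e _ => ?_
      by_cases he : e.left = a
      · subst he
        have h₁ : x₀ * edge R e = 0 := by
          rw [← left_mul_edge, ← mul_assoc, h, zero_mul]
        have h₂ := hedge e
        rw [hall e rfl, h₁, zero_add] at h₂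
        rw [mul_assoc, ghost_mul_left, ← right_mul_ghost, ← mul_assoc, ← h₂, zero_mul]
      · rw [mul_assoc, ghost_mul_vertex_of_ne R he, mul_zero]

end Ghosts

/-! ### Primeness -/

section Prime

variable {R : Type w} {V : Type u} [CommRing R] [Quiver.{v} V]

/-- A nonzero ideal contains a nonzero multiple of a vertex plus longer paths. -/
theorem exists_smul_vertex_add_mem {I : TwoSidedIdeal (LeavittPathAlgebra R V)} (hI : I ≠ ⊥) :
    ∃ (a : V) (r : R) (y : LeavittPathAlgebra R V),
      r ≠ 0 ∧ y ∈ pathsGE R V 1 ∧ r • vertex R a + y ∈ I := by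
  obtain ⟨x, hxI, hx⟩ : ∃ x ∈ I, x ≠ 0 := by
    by_contra! h
    exact hI (eq_bot_iff.2 fun x hx => (TwoSidedIdeal.mem_bot _).2 (h x hx))
  obtain ⟨n, hn⟩ := exists_mem_ghostsLT x
  obtain ⟨b, hb, hb0⟩ := exists_mul_mem_pathsGE hn hx
  obtain ⟨m, hm⟩ := exists_mem_pathsLT hb
  obtain ⟨c, a, r, y, hr, hy, h⟩ := exists_mul_mul_vertex_of_mem_pathsLT hm hb0
  refine ⟨a, r, y, hr, hy, ?_⟩
  rw [← h]
  exact I.mul_mem_right _ _ (I.mul_mem_left _ _ (I.mul_mem_right _ _ hxI))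

/-- Conjugation by a path `p` from `a` to `b` turns `r a` plus longer paths into `r b` plus longer
paths, since `p* c p` is zero or a path as long as `c`. -/
theorem exists_smul_vertex_add_mem_of_path {I : TwoSidedIdeal (LeavittPathAlgebra R V)} {a b : V}
    (p : Quiver.Path a b) {r : R}
    (h : ∃ y ∈ pathsGE R V 1, r • vertex R a + y ∈ I) :
    ∃ y ∈ pathsGE R V 1, r • vertex R b + y ∈ I := by
  induction p with
  | nil => exact h
  | @cons b c p e ih =>
    obtain ⟨y, hy, hI⟩ := ih
    let f : Quiver.Total V := ⟨b, c, e⟩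
    refine ⟨ghost R f * (y * edge R f), ghost_mul_mem_pathsGE f (mul_edge_mem_pathsGE f hy), ?_⟩
    have h := I.mul_mem_right _ (edge R f) (I.mul_mem_left (ghost R f) _ hI)
    have h₁ : ghost R f * vertex R b = ghost R f := ghost_mul_left R f
    rwa [mul_add, add_mul, mul_smul_comm, smul_mul_assoc, h₁, ghost_mul_edge_self,
      mul_assoc] at h

theorem nontrivial_of_nontrivial [Nontrivial R] [Nonempty V] :
    Nontrivial (LeavittPathAlgebra R V) := by
  obtain ⟨a⟩ := ‹Nonempty V›
  exact nontrivial_of_ne _ _ (smul_vertex_ne_zero (one_ne_zero (α := R)) a)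

theorem isPrime_of_isDomain_of_isDownwardDirected [IsDomain R] [Nonempty V]
    (hV : IsDownwardDirected V) : IsPrimeNonUnitalRing (LeavittPathAlgebra R V) := by
  refine ⟨nontrivial_of_nontrivial, fun I J hIJ => ?_⟩
  by_contra! hne
  obtain ⟨a, r, x, hr, hx, hI⟩ := exists_smul_vertex_add_mem hne.1
  obtain ⟨b, s, y, hs, hy, hJ⟩ := exists_smul_vertex_add_mem hne.2
  obtain ⟨c, ⟨p⟩, ⟨q⟩⟩ := hV a b
  obtain ⟨x', hx', hI'⟩ := exists_smul_vertex_add_mem_of_path p ⟨x, hx, hI⟩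
  obtain ⟨y', hy', hJ'⟩ := exists_smul_vertex_add_mem_of_path q ⟨y, hy, hJ⟩
  refine smul_vertex_add_ne_zero (mul_ne_zero hr hs) c (y := r • (vertex R c * y') +
    (s • (x' * vertex R c) + x' * y')) ?_ ?_
  · exact Submodule.add_mem _ (Submodule.smul_mem _ _ (vertex_mul_mem_pathsGE c hy'))
      (Submodule.add_mem _ (Submodule.smul_mem _ _ (mul_vertex_mem_pathsGE c hx'))
        (mul_mem_pathsGE_one hx' hy'))
  · rw [← hIJ _ hI' _ hJ', add_mul, mul_add, mul_add, smul_mul_smul_comm, vertex_mul_self,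
      smul_mul_assoc, mul_smul_comm, add_assoc]

/-- In a prime ring, nothing but zero is annihilated by a nonzero ideal. -/
theorem _root_.IsPrimeNonUnitalRing.eq_zero_of_forall_mul_eq_zero {A : Type*} [NonUnitalRing A]
    (hA : IsPrimeNonUnitalRing A) (I : TwoSidedIdeal A) {x y : A} (hxI : x ∈ I) (hx : x ≠ 0)
    (hy : ∀ a ∈ I, a * y = 0) : y = 0 := by
  let J : TwoSidedIdeal A := TwoSidedIdeal.mk' {b | ∀ a ∈ I, a * b = 0}
    (fun a _ => mul_zero a)
    (fun {b c} hb hc a ha => by rw [mul_add, hb a ha, hc a ha, add_zero])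
    (fun {b} hb a ha => by rw [mul_neg, hb a ha, neg_zero])
    (fun {b c} hc a ha => by rw [← mul_assoc, hc _ (I.mul_mem_right _ _ ha)])
    (fun {b c} hb a ha => by rw [← mul_assoc, hb a ha, zero_mul])
  have hJ {b : A} : b ∈ J ↔ ∀ a ∈ I, a * b = 0 := TwoSidedIdeal.mem_mk' ..
  obtain h | h := hA.2 I J fun a ha b hb => hJ.1 hb a ha
  · rw [h, TwoSidedIdeal.mem_bot] at hxI
    exact absurd hxI hx
  · rw [← TwoSidedIdeal.mem_bot A, ← h]
    exact hJ.2 hy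

theorem isDomain_of_isPrime [Nonempty V] (h : IsPrimeNonUnitalRing (LeavittPathAlgebra R V)) :
    IsDomain R := by
  obtain ⟨a⟩ := ‹Nonempty V›
  have : Nontrivial R := by
    by_contra hR
    rw [not_nontrivial_iff_subsingleton] at hR
    obtain ⟨x, y, hxy⟩ := h.1
    apply hxy
    rw [← one_smul R x, ← one_smul R y, Subsingleton.elim (1 : R) 0, zero_smul, zero_smul]
  have : NoZeroDivisors R := by
    refine ⟨fun {r s} hrs => ?_⟩
    by_contra! hne
    let I : TwoSidedIdeal (LeavittPathAlgebra R V) := TwoSidedIdeal.mk' {x | r • x = 0}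
      (smul_zero r)
      (fun {b c} hb hc => by rw [Set.mem_ofPred_eq, smul_add, hb, hc, add_zero])
      (fun {b} hb => by rw [Set.mem_ofPred_eq, smul_neg, hb, neg_zero])
      (fun {b c} hc => by rw [Set.mem_ofPred_eq, ← mul_smul_comm, hc, mul_zero])
      (fun {b c} hb => by rw [Set.mem_ofPred_eq, ← smul_mul_assoc, hb, zero_mul])
    have hI {x} : x ∈ I ↔ r • x = 0 := TwoSidedIdeal.mem_mk' ..
    refine smul_vertex_ne_zero hne.1 a (h.eq_zero_of_forall_mul_eq_zero I
      (x := s • vertex R a) (hI.2 ?_) (smul_vertex_ne_zero hne.2 a) fun x hx => ?_)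
    · rw [smul_smul, hrs, zero_smul]
    · rw [mul_smul_comm, ← smul_mul_assoc, hI.1 hx, zero_mul]
  exact NoZeroDivisors.to_isDomain R

/-- Vertices without a common lower bound are orthogonal with respect to the whole algebra. -/
theorem vertex_mul_mul_vertex_eq_zero {a b : V} (hab : ¬∃ c, Reaches a c ∧ Reaches b c)
    (x : LeavittPathAlgebra R V) : vertex R a * x * vertex R b = 0 := by
  have hpath : ∀ {n : ℕ} {x : LeavittPathAlgebra R V}, IsPathMonomial R n x →
      ∀ a b, vertex R a * x * vertex R b ≠ 0 → Reaches a b := by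
    intro n x hx
    induction hx with
    | of_vertex c =>
      intro a b h
      obtain rfl : a = c := by
        by_contra hne
        exact h (by rw [vertex_mul_of_ne R hne, zero_mul])
      obtain rfl : a = b := by
        by_contra hne
        exact h (by rw [mul_assoc, vertex_mul_of_ne R hne, mul_zero])
      exact ⟨.nil⟩
    | edge_mul e hx ih =>
      intro a b h
      obtain rfl : a = e.left := by
        by_contra hne
        exact h (by rw [← mul_assoc, vertex_mul_edge_of_ne R hne, zero_mul, zero_mul])
      obtain ⟨p⟩ := ih e.right b fun h' => h (by
        rw [← edge_mul_right, mul_assoc, mul_assoc, mul_assoc, ← mul_assoc (vertex R e.right), h',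
          mul_zero, mul_zero])
      exact ⟨(Quiver.Path.nil.cons e.hom).comp p⟩
  have hmon : ∀ {n : ℕ} {x : LeavittPathAlgebra R V}, IsMonomial R n x →
      ∀ a b, vertex R a * x * vertex R b ≠ 0 → ∃ c, Reaches a c ∧ Reaches b c := by
    intro n x hx
    induction hx with
    | of_path hx => exact fun a b h => ⟨b, hpath hx a b h, ⟨.nil⟩⟩
    | @mul_ghost n x hx e ih =>
      intro a b h
      obtain rfl : e.left = b := by
        by_contra hne
        exact h (by rw [mul_assoc, mul_assoc, ghost_mul_vertex_of_ne R hne, mul_zero, mul_zero])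
      obtain ⟨c, hac, ⟨p⟩⟩ := ih a e.right fun h' => h (by
        rw [← right_mul_ghost, ← mul_assoc x, ← mul_assoc, ← mul_assoc, h', zero_mul, zero_mul])
      exact ⟨c, hac, ⟨(Quiver.Path.nil.cons e.hom).comp p⟩⟩
  have hx : x ∈ Submodule.span R {x : LeavittPathAlgebra R V | ∃ n, IsMonomial R n x} := by
    rw [span_isMonomial]; trivial
  induction hx using Submodule.span_induction with
  | mem x hx =>
    obtain ⟨n, hx⟩ := hx
    by_contra h
    exact hab (hmon hx a b h)
  | zero => rw [mul_zero, zero_mul]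
  | add x y _ _ hx hy => rw [mul_add, add_mul, hx, hy, add_zero]
  | smul r x _ hx => rw [mul_smul_comm, smul_mul_assoc, hx, smul_zero]

theorem isDownwardDirected_of_isPrime [Nontrivial R]
    (h : IsPrimeNonUnitalRing (LeavittPathAlgebra R V)) : IsDownwardDirected V := by
  intro a b
  by_contra hab
  have hne (c : V) : vertex R c ≠ 0 := by
    simpa using smul_vertex_ne_zero (one_ne_zero (α := R)) c
  let I : TwoSidedIdeal (LeavittPathAlgebra R V) :=
    TwoSidedIdeal.mk' {x | ∀ y, x * y * vertex R b = 0}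
      (fun y => by rw [zero_mul, zero_mul])
      (fun {c d} hc hd y => by rw [add_mul, add_mul, hc, hd, add_zero])
      (fun {c} hc y => by rw [neg_mul, neg_mul, hc, neg_zero])
      (fun {c d} hd y => by rw [mul_assoc c, mul_assoc c, hd, mul_zero])
      (fun {c d} hc y => by rw [mul_assoc c, hc])
  have hI {x} : x ∈ I ↔ ∀ y, x * y * vertex R b = 0 := TwoSidedIdeal.mem_mk' ..
  refine hne b (h.eq_zero_of_forall_mul_eq_zero I (x := vertex R a)
    (hI.2 (vertex_mul_mul_vertex_eq_zero hab)) (hne a) fun x hx => ?_)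
  rw [← vertex_mul_self, ← mul_assoc, hI.1 hx]

end Prime

end LeavittPathAlgebra

theorem mainTheorem7 (R : Type w) (V : Type u) [CommRing R] [Quiver.{v} V] [Nonempty V] :
    IsPrimeNonUnitalRing (LeavittPathAlgebra R V) ↔ (IsDomain R ∧ IsDownwardDirected V) := by
  refine ⟨fun h => ?_, fun ⟨_, hV⟩ =>
    LeavittPathAlgebra.isPrime_of_isDomain_of_isDownwardDirected hV⟩
  have := LeavittPathAlgebra.isDomain_of_isPrime h
  exact ⟨this, LeavittPathAlgebra.isDownwardDirected_of_isPrime h⟩
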